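/- A matroid is an $(n,r,b)$-matroid if its ground set has exactly $n$ elements, its rank is $r$, and it has exactly $b$ bases. It is called linear here if its elements can be identified with the labelled columns of a matrix over $\mathbb{Q}$ (columns with different labels may be equal) in such a way that a set of elements is independent if and only if the corresponding columns are linearly independent over $\mathbb{Q}$. Theorem 1.2. For each integer $k\ge 3$ there exists $R\in\mathbb{N}$ such that for all integers $r\ge R$ and all integers $b$ with $1\le b\le\binom{r+k}{r}$ there exists a linear $(r+k,r,b)$-matroid. -/

import Mathlib

/-- `M` is an `(n, r, b)`-matroid: its ground set has exactly `n` elements, its rank (the common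
cardinality of its bases) is `r`, and it has exactly `b` bases. All three cardinalities are taken in
`ℕ∞`, so `M` is finite. -/
structure IsWelshMatroid {α : Type*} (M : Matroid α) (n r b : ℕ) : Prop where
  size_eq : M.E.encard = n
  rank_eq : M.eRank = r
  bases_eq : {B : Set α | M.IsBase B}.encard = b

/-- `M` is linear over the field `F`: there is a matrix over `F`, with columns labelled by the
elements of the ground set, such that the independent sets of `M` are exactly the sets of labels
whose columns are linearly independent over `F`. Equal columns with different labels are
different elements. (Columns labelled by elements of `α` outside the ground set play no role.) -/
def IsLinearMatroid (F : Type*) [Field F] {α : Type*} (M : Matroid α) : Prop :=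
  ∃ (m : ℕ) (A : Matrix (Fin m) α F),
    ∀ I : Set α, M.Indep I ↔ I ⊆ M.E ∧ LinearIndepOn F A.col I

/-! Complements of bases are the bases of the dual, so it suffices to find `n = r + k` vectors in `ℚ
^ k`, `k = s + 1`, with exactly `b` bases. Zero vectors are free padding, so take the least `m + 1`
with `b ≤ (m + 1).choose k`; by Pascal's rule the deficit `d = (m + 1).choose k - b` is below
`m.choose s`.

Disjoint groups of points, generic in distinct hyperplanes, make the `k`-subsets of the groups the
only nonbases. So `d` must be a sum of terms `l.choose k` with the `l` adding up to at most `m + 1`.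
Greedy choice does this (`exists_list_sum_choose`): as `m.choose s` has degree only `s`, the first
group has size at most `m / 4` for large `m`, and the new remainder satisfies the same kind of
bound. The total is at most `m / 2 + C`, which fits once `m ≥ 2 * C`; the finitely many smaller `b`
come from a parallel class with coloops. -/

/-! ### Binomial sums and disjoint groups of small total size -/

/-- Degree `s + 1` beats degree `s`: with `y = x / 4 + 1`, the left side is at most `(4 * y) ^ s`
and the right side at least `(y / 2) ^ (s + 1) / (s + 1)!`. -/
theorem choose_le_choose_quarter {s x : ℕ} (hx : 4 * (2 ^ (s + 1) * (s + 1).factorial * 4 ^ s) ≤ x) :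
    x.choose s ≤ (x / 4 + 1).choose (s + 1) := by
  set K := 2 ^ (s + 1) * (s + 1).factorial * 4 ^ s with hK
  obtain ⟨y, hy⟩ : ∃ y, y = x / 4 + 1 := ⟨_, rfl⟩
  rw [← hy]
  have hxy : x ≤ 4 * y := by omega
  have hKy : K ≤ y := by omega
  have hsK : 2 * s ≤ K := by
    have h1 : s + 1 ≤ (s + 1).factorial := Nat.self_le_factorial _
    have h2 : 2 ≤ 2 ^ (s + 1) := Nat.le_self_pow (by omega) 2
    have h3 : 1 ≤ 4 ^ s := Nat.one_le_pow _ _ (by norm_num)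
    calc 2 * s ≤ 2 * (s + 1) * 1 := by omega
      _ ≤ K := by rw [hK]; gcongr
  have h4 : (y + 1 - (s + 1)) ^ (s + 1) ≤ (s + 1).factorial * y.choose (s + 1) := by
    rw [← Nat.descFactorial_eq_factorial_mul_choose]
    exact Nat.pow_sub_le_descFactorial _ _
  have h5 : y ^ (s + 1) ≤ 2 ^ (s + 1) * ((s + 1).factorial * y.choose (s + 1)) := by
    calc y ^ (s + 1) ≤ (2 * (y + 1 - (s + 1))) ^ (s + 1) := by gcongr; omega
      _ = 2 ^ (s + 1) * (y + 1 - (s + 1)) ^ (s + 1) := mul_pow _ _ _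
      _ ≤ _ := by gcongr
  have h6 : K * y ^ s ≤ y ^ (s + 1) := by rw [pow_succ']; gcongr
  have h7 : x.choose s ≤ 4 ^ s * y ^ s := by
    calc x.choose s ≤ x ^ s := Nat.choose_le_pow _ _
      _ ≤ (4 * y) ^ s := by gcongr
      _ = _ := mul_pow _ _ _
  have h8 : 0 < 2 ^ (s + 1) * (s + 1).factorial := by positivity
  refine Nat.le_of_mul_le_mul_left ?_ h8
  calc 2 ^ (s + 1) * (s + 1).factorial * x.choose s
      ≤ 2 ^ (s + 1) * (s + 1).factorial * (4 ^ s * y ^ s) := by gcongr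
    _ = K * y ^ s := by rw [hK]; ring
    _ ≤ _ := h6.trans (h5.trans (by rw [mul_assoc]))

/-- Greedy representation of `d` as a sum of binomial coefficients with few elements in total. -/
theorem exists_list_sum_choose (s : ℕ) :
    ∃ C : ℕ, ∀ x d : ℕ, d < x.choose s →
      ∃ L : List ℕ, (L.map (·.choose (s + 1))).sum = d ∧ L.sum ≤ x / 2 + C := by
  set x₀ := 4 * (2 ^ (s + 1) * (s + 1).factorial * 4 ^ s) with hx₀
  have hpos : 0 < x₀ := by positivity
  -- Below `x₀`, `d` groups of size `s + 1` contribute one each; the constant bounds their total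
  -- size.
  refine ⟨x₀.choose s * (s + 1), fun x => ?_⟩
  induction x using Nat.strong_induction_on with
  | _ x ih =>
  intro d hd
  rcases lt_or_ge x x₀ with hx | hx
  · refine ⟨List.replicate d (s + 1), by simp, ?_⟩
    have : d ≤ x₀.choose s := hd.le.trans (Nat.choose_le_choose s hx.le)
    calc (List.replicate d (s + 1)).sum = d * (s + 1) := by simp
      _ ≤ x₀.choose s * (s + 1) := by gcongr
      _ ≤ _ := Nat.le_add_left _ _
  · have hq : d < (x / 4 + 1).choose (s + 1) := hd.trans_le (choose_le_choose_quarter hx)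
    have hex : ∃ m, d < (m + 1).choose (s + 1) := ⟨_, hq⟩
    obtain ⟨m, hm, hmin⟩ : ∃ m, d < (m + 1).choose (s + 1) ∧
        ∀ m' < m, ¬ d < (m' + 1).choose (s + 1) :=
      ⟨Nat.find hex, Nat.find_spec hex, fun _ => Nat.find_min hex⟩
    have hmx : m ≤ x / 4 := by
      by_contra! h
      exact hmin _ h hq
    have hmd : m.choose (s + 1) ≤ d := by
      cases m with
      | zero => simp
      | succ m => exact not_lt.1 (hmin m (by omega))
    -- Pascal's rule leaves a remainder below `m.choose s`, the induction hypothesis at `m`. The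
    -- total is at most `m + m / 2 + C` with `m ≤ x / 4`.
    rw [Nat.choose_succ_succ'] at hm
    obtain ⟨L, hL, hLs⟩ := ih m (by omega) (d - m.choose (s + 1)) (by omega)
    refine ⟨m :: L, by simp [hL, hmd], ?_⟩
    rw [List.sum_cons]
    omega

open Finset Classical in
/-- Pairwise disjoint colour classes of prescribed sizes: `c j = none` means that `j` is uncoloured,
and the monochromatic `k`-subsets of `range n` are counted. -/
theorem exists_coloring_card_monochromatic {k : ℕ} (hk : 0 < k) (L : List ℕ) :
    ∃ c : ℕ → Option ℕ, (∀ j, L.sum ≤ j → c j = none) ∧ (∀ j i, c j = some i → i < L.length) ∧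
      ∀ n, L.sum ≤ n → #{T ∈ powersetCard k (range n) | ∃ i, ∀ j ∈ T, c j = some i} =
        (L.map (·.choose k)).sum := by
  induction L with
  | nil =>
    refine ⟨fun _ => none, by simp, by simp, fun n _ => ?_⟩
    rw [List.map_nil, List.sum_nil, card_eq_zero, filter_eq_empty_iff]
    rintro T hT ⟨i, hi⟩
    obtain ⟨j, hj⟩ := card_pos.1 (hk.trans_eq (mem_powersetCard.1 hT).2.symm)
    simpa using hi j hj
  | cons m L ih =>
    obtain ⟨c, hc, hlt, hcard⟩ := ih
    have hnew : ∀ j ∈ Ico L.sum (L.sum + m), c j = none := fun j hj => hc j (mem_Ico.1 hj).1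
    refine ⟨fun j => if j ∈ Ico L.sum (L.sum + m) then some L.length else c j, ?_, ?_, ?_⟩
    · intro j hj
      rw [List.sum_cons] at hj
      beta_reduce
      rw [if_neg (by rw [mem_Ico]; omega)]
      exact hc j (by omega)
    · intro j i hji
      rw [List.length_cons]
      beta_reduce at hji
      split_ifs at hji
      · simp at hji; omega
      · exact (hlt j i hji).trans (Nat.lt_succ_self _)
    · intro n hn
      rw [List.sum_cons] at hn
      have hsplit : {T ∈ powersetCard k (range n) | ∃ i, ∀ j ∈ T,
            (if j ∈ Ico L.sum (L.sum + m) then some L.length else c j) = some i} =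
          powersetCard k (Ico L.sum (L.sum + m)) ∪
            {T ∈ powersetCard k (range n) | ∃ i, ∀ j ∈ T, c j = some i} := by
        ext T
        simp only [mem_filter, mem_union, mem_powersetCard]
        constructor
        · rintro ⟨⟨hTn, hTk⟩, i, hi⟩
          by_cases h : i = L.length
          · left
            refine ⟨fun j hj => ?_, hTk⟩
            by_contra hj'
            have := hi j hj
            rw [if_neg hj'] at this
            exact absurd (hlt _ _ this) (by omega)
          · right
            refine ⟨⟨hTn, hTk⟩, i, fun j hj => ?_⟩
            have := hi j hj
            split_ifs at this
            · exact absurd (Option.some.inj this).symm h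
            · exact this
        · rintro (⟨hT, hTk⟩ | ⟨hT, i, hi⟩)
          · refine ⟨⟨fun j hj => ?_, hTk⟩, L.length, fun j hj => if_pos (hT hj)⟩
            have := mem_Ico.1 (hT hj)
            rw [mem_range]; omega
          · refine ⟨hT, i, fun j hj => ?_⟩
            rw [if_neg, hi j hj]
            intro h
            simpa [hi j hj] using hnew j h
      rw [hsplit, card_union_of_disjoint, hcard n (by omega), card_powersetCard, Nat.card_Ico]
      · simp
      · rw [disjoint_left]
        intro T hT hT'
        obtain ⟨hT', i, hi⟩ := mem_filter.1 hT'
        obtain ⟨j, hj⟩ := card_pos.1 (hk.trans_eq (mem_powersetCard.1 hT').2.symm)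
        simpa [hi j hj] using hnew j ((mem_powersetCard.1 hT).1 hj)

/-! ### Generic vectors in prescribed subspaces -/

section GeneralPosition

variable {K V : Type*} [Field K] [AddCommGroup V] [Module K V]

/-- Over an infinite field, `U` is not a finite union of proper subspaces, here the traces of the
`W`. -/
theorem Submodule.exists_mem_forall_notMem [Infinite K] (U : Submodule K V)
    (S : Finset (Submodule K V)) (hS : ∀ W ∈ S, ¬ U ≤ W) : ∃ x ∈ U, ∀ W ∈ S, x ∉ W := by
  classical
  have h := Subspace.biUnion_ne_univ_of_top_notMem (k := K) (E := U)
    (s := (S.image fun W => W.comap U.subtype)) (by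
      intro h
      obtain ⟨W, hW, hWt⟩ := Finset.mem_image.1 h
      exact hS W hW (Submodule.comap_subtype_eq_top.1 hWt))
  rw [Set.ne_univ_iff_exists_notMem] at h
  obtain ⟨x, hx⟩ := h
  refine ⟨x, x.2, fun W hW hxW => hx ?_⟩
  simp only [Set.mem_iUnion]
  exact ⟨_, Finset.mem_image_of_mem _ hW, hxW⟩

/-- Vectors chosen one after another in prescribed subspaces, each as general as possible. -/
theorem exists_forall_mem_generic [Infinite K] (U : ℕ → Submodule K V) (N n : ℕ) :
    ∃ v : ℕ → V, ∀ j < n, v j ∈ U j ∧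
      (∀ T ⊆ Finset.range j, v j ∈ Submodule.span K (v '' T) → U j ≤ Submodule.span K (v '' T)) ∧
      ∀ i < N, v j ∈ U i → U j ≤ U i := by
  classical
  induction n with
  | zero => exact ⟨0, by simp⟩
  | succ n ih =>
    obtain ⟨v, hv⟩ := ih
    -- Avoid every span of earlier vectors and every `U i` that does not contain `U n`.
    obtain ⟨x, hxU, hx⟩ := (U n).exists_mem_forall_notMem
      (((Finset.range n).powerset.image (fun T : Finset ℕ => Submodule.span K (v '' T)) ∪
        (Finset.range N).image U).filter fun W => ¬ U n ≤ W)
      (fun W hW => (Finset.mem_filter.1 hW).2)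
    have himg : ∀ j ≤ n, ∀ T ⊆ Finset.range j,
        Function.update v n x '' (T : Set ℕ) = v '' T := by
      intro j hj T hT
      refine Set.image_congr fun i hi => Function.update_of_ne ?_ _ _
      have := Finset.mem_range.1 (hT hi)
      omega
    refine ⟨Function.update v n x, fun j hj => ?_⟩
    rcases Nat.lt_succ_iff_lt_or_eq.1 hj with hj | rfl
    · rw [Function.update_of_ne hj.ne]
      refine ⟨(hv j hj).1, fun T hT => ?_, (hv j hj).2.2⟩
      rw [himg j hj.le T hT]
      exact (hv j hj).2.1 T hT
    · rw [Function.update_self]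
      refine ⟨hxU, fun T hT => ?_, fun i hi h => ?_⟩
      · rw [himg j le_rfl T hT]
        intro h
        by_contra hle
        refine hx _ (Finset.mem_filter.2 ⟨Finset.mem_union_left _ ?_, hle⟩) h
        exact Finset.mem_image_of_mem (fun T : Finset ℕ => Submodule.span K (v '' T))
          (Finset.mem_powerset.2 hT)
      · by_contra hle
        exact hx _ (Finset.mem_filter.2 ⟨Finset.mem_union_right _
          (Finset.mem_image_of_mem _ (Finset.mem_range.2 hi)), hle⟩) h

theorem LinearIndepOn.finrank_span_image_eq_ncard {ι : Type*} {v : ι → V} {s : Set ι}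
    (h : LinearIndepOn K v s) (hs : s.Finite) :
    Module.finrank K (Submodule.span K (v '' s)) = s.ncard := by
  have := hs.fintype
  rw [Set.image_eq_range, finrank_span_eq_card h.linearIndependent, Set.ncard_eq_toFinset_card',
    Set.toFinset_card]

theorem LinearIndepOn.finrank_span_image {ι : Type*} {v : ι → V} {T : Finset ι}
    (h : LinearIndepOn K v (T : Set ι)) :
    Module.finrank K (Submodule.span K (v '' (T : Set ι))) = T.card := by
  rw [h.finrank_span_image_eq_ncard T.finite_toSet, Set.ncard_coe_finset]

variable [FiniteDimensional K V] {U : ℕ → Submodule K V} {v : ℕ → V} {n s : ℕ}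

/-- Genericity controls only spans of earlier vectors, so the largest index is added last: were it
dependent, `U j`, of dimension at least `s`, would lie in a span of fewer than `s` vectors. -/
theorem linearIndepOn_of_card_le (hs : ∀ j, s ≤ Module.finrank K (U j))
    (hspan : ∀ j < n, ∀ T ⊆ Finset.range j,
      v j ∈ Submodule.span K (v '' T) → U j ≤ Submodule.span K (v '' T))
    {T : Finset ℕ} (hT : T ⊆ Finset.range n) (hc : T.card ≤ s) :
    LinearIndepOn K v (T : Set ℕ) := by
  induction T using Finset.induction_on_max with
  | empty => simp
  | insert j T hj ih =>
    have hjT : j ∉ T := fun h => lt_irrefl _ (hj j h)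
    rw [Finset.card_insert_of_notMem hjT] at hc
    have hT' := ih ((Finset.subset_insert _ _).trans hT) (by omega)
    rw [Finset.coe_insert]
    refine hT'.insert fun h => ?_
    have hle := Submodule.finrank_mono (hspan j (Finset.mem_range.1 (hT (Finset.mem_insert_self _ _)))
      T (fun i hi => Finset.mem_range.2 (hj i hi)) h)
    rw [hT'.finrank_span_image] at hle
    have := hs j
    omega

/-- In general position, the only dependent sets of full size lie in one hyperplane `U j`. -/
theorem linearIndepOn_iff_not_common_hyperplane (hs : ∀ j, s ≤ Module.finrank K (U j)) (hmem : ∀ j < n, v j ∈ U j)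
    (hspan : ∀ j < n, ∀ T ⊆ Finset.range j,
      v j ∈ Submodule.span K (v '' T) → U j ≤ Submodule.span K (v '' T))
    (hU : ∀ j < n, ∀ i < n, v j ∈ U i → U j ≤ U i)
    {T : Finset ℕ} (hT : T ⊆ Finset.range n) (hc : T.card = s + 1) :
    LinearIndepOn K v (T : Set ℕ) ↔
      ¬ ∃ W : Submodule K V, Module.finrank K W = s ∧ ∀ j ∈ T, U j = W := by
  constructor
  · rintro h ⟨W, hW, hTW⟩
    have hle : Submodule.span K (v '' (T : Set ℕ)) ≤ W := by
      rw [Submodule.span_le]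
      rintro _ ⟨j, hj, rfl⟩
      rw [← hTW j hj]
      exact hmem j (Finset.mem_range.1 (hT hj))
    have := Submodule.finrank_mono hle
    rw [h.finrank_span_image] at this
    omega
  · intro h
    obtain ⟨j, T', hj, rfl⟩ : ∃ j T', (∀ i ∈ T', i < j) ∧ T = insert j T' := by
      have hne : T.Nonempty := Finset.card_pos.1 (by omega)
      refine ⟨T.max' hne, T.erase (T.max' hne), fun i hi => T.lt_max'_of_mem_erase_max' hne hi, ?_⟩
      rw [Finset.insert_erase (T.max'_mem hne)]
    have hjT : j ∉ T' := fun h => lt_irrefl _ (hj j h)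
    rw [Finset.card_insert_of_notMem hjT] at hc
    have hjn : j < n := Finset.mem_range.1 (hT (Finset.mem_insert_self _ _))
    have hT'n := (Finset.subset_insert _ _).trans hT
    have hT' := linearIndepOn_of_card_le hs hspan hT'n (by omega)
    rw [Finset.coe_insert]
    refine hT'.insert fun hjs => h ?_
    have hle := hspan j hjn T' (fun i hi => Finset.mem_range.2 (hj i hi)) hjs
    have hfs := hT'.finrank_span_image
    -- The `s` earlier vectors span a space of dimension `s` containing `U j`, hence equal to it.
    -- Each of them then lies in `U j`, which forces `U i ≤ U j` and equality by dimension.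
    have heq : U j = Submodule.span K (v '' (T' : Set ℕ)) :=
      Submodule.eq_of_le_of_finrank_le hle (by have := hs j; omega)
    have hfj : Module.finrank K (U j) = s := by rw [heq]; omega
    refine ⟨U j, hfj, fun i hi => ?_⟩
    rcases Finset.mem_insert.1 hi with rfl | hi
    · rfl
    · refine Submodule.eq_of_le_of_finrank_le
        (hU i (Finset.mem_range.1 (hT'n hi)) j hjn ?_) (by rw [hfj]; exact hs i)
      rw [heq]
      exact Submodule.subset_span (Set.mem_image_of_mem _ hi)

end GeneralPosition

/-- A space of dimension at least two has infinitely many hyperplanes over `ℚ`. -/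
theorem exists_injective_hyperplanes {s : ℕ} (hs : 0 < s) :
    ∃ H : ℕ → Submodule ℚ (Fin (s + 1) → ℚ), Function.Injective H ∧
      ∀ i, Module.finrank ℚ (H i) = s := by
  obtain ⟨s, rfl⟩ : ∃ t, s = t + 1 := ⟨s - 1, by omega⟩
  let f : ℕ → (Fin (s + 1 + 1) → ℚ) →ₗ[ℚ] ℚ := fun i =>
    LinearMap.proj 0 - (i : ℚ) • LinearMap.proj 1
  have hf : ∀ i x, f i x = x 0 - i * x 1 := fun i x => by simp [f]
  refine ⟨fun i => LinearMap.ker (f i), fun i i' h => ?_, fun i => ?_⟩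
  -- The hyperplanes are `x 0 = i * x 1`; the vector `(i, 1, …, 1)` recovers `i`.
  · let x : Fin (s + 1 + 1) → ℚ := fun j => if j = 0 then i else 1
    have hx : x ∈ LinearMap.ker (f i) := by simp [LinearMap.mem_ker, hf, x]
    have hx' : x ∈ LinearMap.ker (f i') := by
      have h' : LinearMap.ker (f i) = LinearMap.ker (f i') := h
      exact h' ▸ hx
    have h0 : (i : ℚ) - i' = 0 := by simpa [LinearMap.mem_ker, hf, x] using hx'
    exact_mod_cast sub_eq_zero.1 h0
  · have hsurj : LinearMap.range (f i) = ⊤ := by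
      rw [LinearMap.range_eq_top]
      intro y
      exact ⟨fun j => if j = 0 then y else 0, by simp [hf]⟩
    have := LinearMap.finrank_range_add_finrank_ker (f i)
    rw [hsurj, finrank_top, Module.finrank_self, Module.finrank_fin_fun] at this
    simp only
    omega

/-! ### Column matroids and duality through linear relations -/

section DualVectors

variable {K V α : Type*} [Field K] [AddCommGroup V] [Module K V]

/-- The column matroid of a matrix with finitely many columns. -/
def Matroid.ofCols [Finite α] {m : ℕ} (A : Matrix (Fin m) α K) : Matroid α :=
  (IndepMatroid.ofFinite (Set.toFinite Set.univ) (fun I => LinearIndepOn K A.col I)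
    (linearIndepOn_empty K A.col)
    (fun _ _ hJ hIJ => hJ.mono hIJ)
    (fun I J hI hJ hlt => by
      -- If no element of `J` extends `I`, the span of `J` lies in that of `I`, against the
      -- cardinalities.
      by_contra! h
      refine hlt.not_ge ?_
      rw [← hI.finrank_span_image_eq_ncard I.toFinite, ← hJ.finrank_span_image_eq_ncard J.toFinite]
      refine Submodule.finrank_mono (Submodule.span_le.2 ?_)
      rintro _ ⟨e, he, rfl⟩
      by_cases heI : e ∈ I
      · exact Submodule.subset_span (Set.mem_image_of_mem _ heI)
      · by_contra hne
        exact h e he heI (hI.insert hne))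
    (fun _ _ => Set.subset_univ _)).matroid

@[simp]
theorem Matroid.ofCols_ground [Finite α] {m : ℕ} (A : Matrix (Fin m) α K) :
    (Matroid.ofCols A).E = Set.univ := rfl

theorem Matroid.ofCols_indep [Finite α] {m : ℕ} (A : Matrix (Fin m) α K) {I : Set α} :
    (Matroid.ofCols A).Indep I ↔ LinearIndepOn K A.col I := Iff.rfl

theorem Matroid.isLinearMatroid_ofCols [Finite α] {m : ℕ} (A : Matrix (Fin m) α K) :
    IsLinearMatroid K (Matroid.ofCols A) :=
  ⟨m, A, fun I => by simp [Matroid.ofCols_indep]⟩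

variable [Fintype α] [DecidableEq α]

/-- The coordinate functionals on the space of linear relations among the vectors `v i`. -/
def relationCoord (v : α → V) (i : α) :
    Module.Dual K (LinearMap.ker (Fintype.linearCombination K v)) :=
  LinearMap.proj i ∘ₗ Submodule.subtype _

/-- A relation supported on the complement of `I` is a relation vanishing on `I`. -/
theorem linearIndepOn_compl_iff_forall_relation (v : α → V) (I : Finset α) :
    LinearIndepOn K v ((Iᶜ : Finset α) : Set α) ↔
      ∀ x : α → K, ∑ i, x i • v i = 0 → (∀ i ∈ I, x i = 0) → x = 0 := by
  rw [linearIndepOn_finset_iff]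
  constructor
  · intro h x hx hxI
    funext i
    by_cases hi : i ∈ I
    · exact hxI i hi
    · refine h x ?_ i (Finset.mem_compl.2 hi)
      rw [← hx]
      refine Finset.sum_subset (Finset.subset_univ _) fun j _ hj => ?_
      rw [hxI j (by simpa using hj), zero_smul]
  · intro h g hg i hi
    have := h (fun j => if j ∈ I then 0 else g j) ?_ (fun j hj => if_pos hj)
    · simpa [Finset.mem_compl.1 hi] using congrFun this i
    · rw [← hg]
      symm
      refine Finset.sum_subset_zero_on_sdiff (Finset.subset_univ _) (fun j hj => ?_)
        (fun j hj => ?_)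
      · have : j ∈ I := by simpa using hj
        simp [this]
      · simp [Finset.mem_compl.1 hj]

/-- Matroid duality for bases, in terms of vectors. -/
theorem linearIndepOn_relationCoord_iff (v : α → V) (I : Finset α)
    (hI : I.card = Module.finrank K (LinearMap.ker (Fintype.linearCombination K v))) :
    LinearIndepOn K (relationCoord (K := K) v) (I : Set α) ↔
      LinearIndepOn K v ((Iᶜ : Finset α) : Set α) := by
  -- As `I` has the dimension of the relation space, its coordinate functionals are independent
  -- exactly when only the zero relation is killed by all of them.
  have hdim := Subspace.finrank_add_finrank_dualCoannihilator_eq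
    (Submodule.span K (relationCoord (K := K) v '' (I : Set α)))
  have h1 : LinearIndepOn K (relationCoord (K := K) v) (I : Set α) ↔
      (Submodule.span K (relationCoord (K := K) v '' (I : Set α))).dualCoannihilator = ⊥ := by
    rw [← Submodule.finrank_eq_zero (R := K)]
    have : LinearIndepOn K (relationCoord (K := K) v) (I : Set α) ↔ I.card =
        Module.finrank K (Submodule.span K (relationCoord (K := K) v '' (I : Set α))) := by
      rw [LinearIndepOn, linearIndependent_iff_card_eq_finrank_span, Set.finrank,
        Set.image_eq_range]
      simp
    rw [this]
    omega
  rw [h1, linearIndepOn_compl_iff_forall_relation, Submodule.eq_bot_iff]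
  have hmem : ∀ x : LinearMap.ker (Fintype.linearCombination K v),
      x ∈ (Submodule.span K (relationCoord (K := K) v '' (I : Set α))).dualCoannihilator ↔
        ∀ i ∈ I, (x : α → K) i = 0 := by
    intro x
    rw [Submodule.mem_dualCoannihilator]
    constructor
    · intro h i hi
      exact h _ (Submodule.subset_span (Set.mem_image_of_mem _ hi))
    · intro h φ hφ
      induction hφ using Submodule.span_induction with
      | mem φ hφ =>
        obtain ⟨i, hi, rfl⟩ := hφ
        exact h i hi
      | zero => rfl
      | add φ ψ _ _ h1 h2 => rw [LinearMap.add_apply, h1, h2, add_zero]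
      | smul a φ _ h1 => rw [LinearMap.smul_apply, h1, smul_zero]
  constructor
  · intro h x hx hxI
    have := h ⟨x, by rwa [LinearMap.mem_ker, Fintype.linearCombination_apply]⟩ ((hmem _).2 hxI)
    exact congrArg Subtype.val this
  · intro h x hx
    refine Subtype.ext (h x ?_ ((hmem x).1 hx))
    rw [← Fintype.linearCombination_apply]
    exact x.2

open Classical in
/-- A spanning family of `r + k` vectors in dimension `k` with `b` bases yields the dual linear
matroid of rank `r`, also with `b` bases. -/
theorem exists_isWelshMatroid_dual {r k b : ℕ} (hα : Fintype.card α = r + k)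
    (v : α → Fin k → K) (hb : 0 < b)
    (hv : (Finset.univ.filter fun T : Finset α =>
      T.card = k ∧ LinearIndepOn K v (T : Set α)).card = b) :
    ∃ M : Matroid α, IsWelshMatroid M (r + k) r b ∧ IsLinearMatroid K M := by
  -- Since `b > 0` some basis exists, so the vectors span and the relation space has dimension `r`.
  obtain ⟨B, hB⟩ := Finset.card_pos.1 (hb.trans_eq hv.symm)
  simp only [Finset.mem_filter, Finset.mem_univ, true_and] at hB
  have hker : Module.finrank K (LinearMap.ker (Fintype.linearCombination K v)) = r := by
    have hrange : LinearMap.range (Fintype.linearCombination K v) = ⊤ := by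
      rw [Fintype.range_linearCombination, eq_top_iff]
      have htop : Submodule.span K (v '' (B : Set α)) = ⊤ :=
        Submodule.eq_top_of_finrank_eq (by rw [hB.2.finrank_span_image, hB.1]; simp)
      rw [← htop]
      exact Submodule.span_mono (Set.image_subset_range _ _)
    have := LinearMap.finrank_range_add_finrank_ker (Fintype.linearCombination K v)
    rw [hrange, finrank_top, Module.finrank_fin_fun, Module.finrank_fintype_fun_eq_card, hα] at this
    omega
  have hdual : Module.finrank K (Module.Dual K (LinearMap.ker (Fintype.linearCombination K v))) =
      Module.finrank K (Fin r → K) := by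
    rw [Subspace.dual_finrank_eq, hker, Module.finrank_fin_fun]
  let e := LinearEquiv.ofFinrankEq _ _ hdual
  let A : Matrix (Fin r) α K := Matrix.of fun l i => e (relationCoord v i) l
  have hA : ∀ I : Finset α, I.card = r →
      (LinearIndepOn K A.col (I : Set α) ↔ LinearIndepOn K v ((Iᶜ : Finset α) : Set α)) := by
    intro I hI
    rw [← linearIndepOn_relationCoord_iff v I (hI.trans hker.symm)]
    exact e.toLinearMap.linearIndepOn_iff_of_injOn e.injective.injOn
  have hcard : ∀ I : Set α, LinearIndepOn K A.col I → I.ncard ≤ r := by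
    intro I hI
    rw [← hI.finrank_span_image_eq_ncard I.toFinite]
    simpa using Submodule.finrank_le (Submodule.span K (A.col '' I))
  have hbase : ∀ I : Set α, I.ncard = r → LinearIndepOn K A.col I →
      (Matroid.ofCols A).IsBase I := by
    intro I hI hind
    refine (Matroid.ofCols_indep A |>.2 hind).isBase_of_maximal fun J hJ hIJ => ?_
    exact Set.eq_of_subset_of_ncard_le hIJ (by rw [hI]; exact hcard J hJ) J.toFinite
  have hBc : (Bᶜ).card = r := by rw [Finset.card_compl, hα, hB.1]; omega
  have hBbase : (Matroid.ofCols A).IsBase ((Bᶜ : Finset α) : Set α) :=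
    hbase _ (by rw [Set.ncard_coe_finset, hBc]) ((hA _ hBc).2 (by rw [compl_compl]; exact hB.2))
  have hrank : (Matroid.ofCols A).eRank = r := by
    rw [← hBbase.encard_eq_eRank, Set.encard_coe_eq_coe_finsetCard, hBc]
  refine ⟨Matroid.ofCols A, ⟨?_, hrank, ?_⟩, Matroid.isLinearMatroid_ofCols A⟩
  · rw [Matroid.ofCols_ground, Set.encard_univ, ENat.card_eq_coe_fintype_card, hα]
  · have : {I : Set α | (Matroid.ofCols A).IsBase I} = (fun T : Finset α => ((Tᶜ : Finset α) : Set α)) ''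
        (Finset.univ.filter fun T : Finset α =>
          T.card = k ∧ LinearIndepOn K v (T : Set α) : Finset (Finset α)) := by
      ext I
      obtain ⟨I, rfl⟩ := I.toFinite.exists_finset_coe
      simp only [Set.mem_ofPred_eq, Set.mem_image, Finset.coe_filter, Finset.mem_univ, true_and,
        Finset.coe_inj]
      constructor
      · intro hI
        have hIr : I.card = r := by
          have := hI.encard_eq_eRank
          rw [hrank, Set.encard_coe_eq_coe_finsetCard] at this
          exact_mod_cast this
        exact ⟨Iᶜ, ⟨by rw [Finset.card_compl, hα, hIr]; omega, (hA I hIr).1 hI.indep⟩,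
          compl_compl I⟩
      · rintro ⟨T, ⟨hTk, hT⟩, rfl⟩
        have hTr : (Tᶜ).card = r := by rw [Finset.card_compl, hα, hTk]; omega
        exact hbase _ (by rw [Set.ncard_coe_finset, hTr])
          ((hA _ hTr).2 (by rw [compl_compl]; exact hT))
    rw [this, Set.InjOn.encard_image, Set.encard_coe_eq_coe_finsetCard, hv]
    exact (Finset.coe_injective.comp compl_injective).injOn

end DualVectors

/-! ### Vector families with a prescribed number of bases -/

open Finset Classical in
/-- Some sequence of vectors in `ℚ ^ k` has exactly `b` bases among its first `n` members. -/
def HasBasisCount (k n b : ℕ) : Prop :=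
  ∃ v : ℕ → Fin k → ℚ,
    #((powersetCard k (range n)).filter fun T : Finset ℕ => LinearIndepOn ℚ v (T : Set ℕ)) = b

/-- Appending zero vectors does not change the number of bases. -/
theorem HasBasisCount.mono {k n n' b : ℕ} (h : HasBasisCount k n b) (hn : n ≤ n') :
    HasBasisCount k n' b := by
  classical
  obtain ⟨v, rfl⟩ := h
  refine ⟨fun j => if j < n then v j else 0, congrArg Finset.card ?_⟩
  have hv : ∀ T ⊆ Finset.range n,
      (LinearIndepOn ℚ (fun j => if j < n then v j else 0) (T : Set ℕ) ↔
        LinearIndepOn ℚ v (T : Set ℕ)) := fun T hT =>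
    linearIndepOn_congr fun j hj => if_pos (Finset.mem_range.1 (hT hj))
  ext T
  simp only [Finset.mem_filter, Finset.mem_powersetCard]
  constructor
  · rintro ⟨⟨-, hTk⟩, hT⟩
    have hTn : T ⊆ Finset.range n := fun j hj => by
      by_contra hjn
      exact hT.ne_zero (Finset.mem_coe.2 hj) (if_neg (by simpa using hjn))
    exact ⟨⟨hTn, hTk⟩, (hv T hTn).1 hT⟩
  · rintro ⟨⟨hTn, hTk⟩, hT⟩
    exact ⟨⟨hTn.trans (Finset.range_subset_range.2 hn), hTk⟩, (hv T hTn).2 hT⟩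

/-- `s` coloops together with one parallel class of size `b`. -/
theorem hasBasisCount_add (s b : ℕ) : HasBasisCount (s + 1) (b + s) b := by
  classical
  -- Indices below `s` get distinct unit vectors; all others share the last one.
  let f : ℕ → Fin (s + 1) := fun j => ⟨min j s, by omega⟩
  have hfval : ∀ j, (f j : ℕ) = min j s := fun _ => rfl
  have hbasis : LinearIndependent ℚ (fun i : Fin (s + 1) => (Pi.single i 1 : Fin (s + 1) → ℚ)) :=
    Pi.linearIndependent_single_one _ _
  refine ⟨fun j => Pi.single (f j) 1, ?_⟩
  have hind : ∀ T : Finset ℕ, LinearIndepOn ℚ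
      (fun j => (Pi.single (f j) 1 : Fin (s + 1) → ℚ)) (T : Set ℕ) ↔ Set.InjOn f T := by
    intro T
    constructor
    · intro h i hi j hj hij
      exact h.injOn hi hj (by simp only [hij])
    · intro h
      exact hbasis.comp (fun j : (T : Set ℕ) => f j) h.injective
  have hinj : Set.InjOn (fun j => insert j (Finset.range s)) (Finset.Ico s (b + s)) := by
    intro i hi j hj hij
    simp only [Finset.coe_Ico, Set.mem_Ico] at hi hj
    have : i ∈ insert j (Finset.range s) := by
      rw [← show insert i (Finset.range s) = insert j (Finset.range s) from hij]
      exact Finset.mem_insert_self _ _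
    rw [Finset.mem_insert, Finset.mem_range] at this
    omega
  have hcard := Finset.card_image_of_injOn hinj
  rw [Nat.card_Ico, Nat.add_sub_cancel] at hcard
  refine Eq.trans (congrArg Finset.card ?_) hcard
  ext T
  simp only [Finset.mem_filter, Finset.mem_powersetCard, Finset.mem_image, hind]
  constructor
  · rintro ⟨⟨hTn, hTk⟩, hT⟩
    have hsurj : T.image f = Finset.univ := by
      refine Finset.eq_univ_of_card _ ?_
      rw [Finset.card_image_of_injOn hT, hTk, Fintype.card_fin]
    have hex : ∀ i : Fin (s + 1), ∃ j ∈ T, f j = i := fun i =>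
      Finset.mem_image.1 (hsurj ▸ Finset.mem_univ i)
    obtain ⟨j, hj, hjs⟩ := hex (Fin.last s)
    have hjs' : s ≤ j := by
      have := congrArg Fin.val hjs
      rw [hfval, Fin.val_last] at this
      omega
    have hsub : insert j (Finset.range s) ⊆ T := by
      refine Finset.insert_subset hj fun i hi => ?_
      rw [Finset.mem_range] at hi
      obtain ⟨i', hi', hii'⟩ := hex ⟨i, by omega⟩
      have := congrArg Fin.val hii'
      rw [hfval] at this
      simp only at this
      obtain rfl : i' = i := by omega
      exact hi'
    refine ⟨j, ?_, Finset.eq_of_subset_of_card_le hsub ?_⟩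
    · have := Finset.mem_range.1 (hTn hj)
      rw [Finset.mem_Ico]; omega
    · rw [hTk, Finset.card_insert_of_notMem (by simpa using hjs'), Finset.card_range]
  · rintro ⟨j, hj, rfl⟩
    rw [Finset.mem_Ico] at hj
    refine ⟨⟨?_, ?_⟩, ?_⟩
    · intro i hi
      rw [Finset.mem_insert, Finset.mem_range] at hi
      rw [Finset.mem_range]
      omega
    · rw [Finset.card_insert_of_notMem (by simpa using hj.1), Finset.card_range]
    · intro a ha c hc hac
      have hac := congrArg Fin.val hac
      simp only [hfval, Finset.coe_insert, Finset.coe_range, Set.mem_insert_iff,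
        Set.mem_Iio] at ha hc hac
      omega

/-- Placing disjoint groups of points generically in distinct hyperplanes, and the remaining points
generically, the nonbases are the subsets of the groups. -/
theorem hasBasisCount_of_list {s n d : ℕ} (hs : 0 < s) (L : List ℕ)
    (hL : (L.map (·.choose (s + 1))).sum = d) (hLn : L.sum ≤ n) :
    HasBasisCount (s + 1) n (n.choose (s + 1) - d) := by
  classical
  obtain ⟨c, -, -, hc⟩ := exists_coloring_card_monochromatic (Nat.succ_pos s) L
  obtain ⟨H, hH, hHs⟩ := exists_injective_hyperplanes hs
  -- Uncoloured points range over the whole space, of dimension `s + 1`, so they never share a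
  -- hyperplane.
  let U : ℕ → Submodule ℚ (Fin (s + 1) → ℚ) := fun j => (c j).elim ⊤ H
  have hUnone : ∀ {j}, c j = none → U j = ⊤ := fun h => by simp only [U, h, Option.elim_none]
  have hUsome : ∀ {j i}, c j = some i → U j = H i := fun h => by
    simp only [U, h, Option.elim_some]
  have hUs : ∀ j, s ≤ Module.finrank ℚ (U j) := by
    intro j
    rcases hj : c j with _ | i
    · rw [hUnone hj, finrank_top, Module.finrank_fin_fun]
      omega
    · rw [hUsome hj, hHs]
  obtain ⟨v, hv⟩ := exists_forall_mem_generic U n n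
  refine ⟨v, ?_⟩
  have hdep : ∀ T ∈ Finset.powersetCard (s + 1) (Finset.range n),
      (LinearIndepOn ℚ v (T : Set ℕ) ↔ ¬ ∃ i, ∀ j ∈ T, c j = some i) := by
    intro T hT
    obtain ⟨hTn, hTs⟩ := Finset.mem_powersetCard.1 hT
    rw [linearIndepOn_iff_not_common_hyperplane hUs (fun j hj => (hv j hj).1)
      (fun j hj => (hv j hj).2.1) (fun j hj => (hv j hj).2.2) hTn hTs, not_iff_not]
    constructor
    · rintro ⟨W, hW, hTW⟩
      obtain ⟨j₀, hj₀⟩ := Finset.card_pos.1 ((Nat.succ_pos s).trans_eq hTs.symm)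
      have hsome : ∀ j ∈ T, ∃ i, c j = some i ∧ H i = W := by
        intro j hj
        have hjW := hTW j hj
        rcases hcj : c j with _ | i
        · exfalso
          have : Module.finrank ℚ (U j) = s + 1 := by
            rw [hUnone hcj, finrank_top, Module.finrank_fin_fun]
          rw [hjW, hW] at this
          omega
        · exact ⟨i, rfl, (hUsome hcj).symm.trans hjW⟩
      obtain ⟨i, -, hi⟩ := hsome j₀ hj₀
      refine ⟨i, fun j hj => ?_⟩
      obtain ⟨i', hji', hi'⟩ := hsome j hj
      rw [hji', hH (hi'.trans hi.symm)]
    · rintro ⟨i, hi⟩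
      exact ⟨H i, hHs i, fun j hj => hUsome (hi j hj)⟩
  rw [Finset.filter_congr hdep, Finset.filter_not, Finset.card_sdiff_of_subset
    (Finset.filter_subset _ _), hc n hLn, Finset.card_powersetCard, Finset.card_range, hL]

theorem exists_forall_hasBasisCount {s : ℕ} (hs : 0 < s) :
    ∃ N : ℕ, ∀ n, N ≤ n → ∀ b ≤ n.choose (s + 1), HasBasisCount (s + 1) n b := by
  obtain ⟨C, hC⟩ := exists_list_sum_choose s
  -- The first two summands leave room for the `b + s` vectors used when `b ≤ (2 * C).choose (s +
  -- 1)`.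
  refine ⟨(2 * C).choose (s + 1) + s + 2 * C, fun n hn b hb => ?_⟩
  rcases le_or_gt b ((2 * C).choose (s + 1)) with hsmall | hlarge
  · exact (hasBasisCount_add s b).mono (by omega)
  have hex : ∃ m : ℕ, b ≤ m.choose (s + 1) := ⟨n, hb⟩
  obtain ⟨m, hm, hmin⟩ : ∃ m : ℕ, b ≤ m.choose (s + 1) ∧ ∀ m' < m, ¬ b ≤ Nat.choose m' (s + 1) :=
    ⟨Nat.find hex, Nat.find_spec hex, fun _ => Nat.find_min hex⟩
  have hmn : m ≤ n := by
    by_contra! h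
    exact hmin n h hb
  have hCm : 2 * C < m := by
    by_contra! h
    exact absurd (hm.trans (Nat.choose_le_choose _ h)) (by omega)
  obtain ⟨m, rfl⟩ : ∃ m', m = m' + 1 := ⟨m - 1, by omega⟩
  have hb' := hmin m (Nat.lt_succ_self m)
  have hpascal := Nat.choose_succ_succ' m s
  -- Minimality and Pascal's rule bound the deficit; `2 * C ≤ m` makes the groups fit into `m + 1`
  -- points.
  obtain ⟨L, hL, hLs⟩ := hC m ((m + 1).choose (s + 1) - b) (by omega)
  have := hasBasisCount_of_list hs L hL (n := m + 1) (by omega)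
  rw [Nat.sub_sub_self hm] at this
  exact this.mono hmn

theorem HasBasisCount.exists_isWelshMatroid {r k b : ℕ} (h : HasBasisCount k (r + k) b)
    (hb : 0 < b) :
    ∃ M : Matroid (Fin (r + k)), IsWelshMatroid M (r + k) r b ∧ IsLinearMatroid ℚ M := by
  classical
  obtain ⟨v, hv⟩ := h
  refine exists_isWelshMatroid_dual (Fintype.card_fin _) (fun i : Fin (r + k) => v i) hb ?_
  rw [← hv]
  have hind : ∀ T : Finset (Fin (r + k)), LinearIndepOn ℚ (fun i : Fin (r + k) => v i) (T : Set _) ↔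
      LinearIndepOn ℚ v ((T.map Fin.valEmbedding : Finset ℕ) : Set ℕ) := by
    intro T
    rw [Finset.coe_map]
    exact ⟨LinearIndepOn.image_of_comp (R := ℚ) Fin.val v,
      fun h => h.comp_of_image Fin.val_injective.injOn⟩
  refine Finset.card_bij (fun T _ => T.map Fin.valEmbedding) ?_ ?_ ?_
  · intro T hT
    obtain ⟨-, hTk, hT⟩ := Finset.mem_filter.1 hT
    refine Finset.mem_filter.2 ⟨Finset.mem_powersetCard.2 ⟨fun j hj => ?_, ?_⟩, (hind T).1 hT⟩
    · obtain ⟨i, -, rfl⟩ := Finset.mem_map.1 hj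
      exact Finset.mem_range.2 i.2
    · rw [Finset.card_map, hTk]
  · intro T _ T' _ hTT'
    exact Finset.map_injective _ hTT'
  · intro S hS
    obtain ⟨hS, hSind⟩ := Finset.mem_filter.1 hS
    obtain ⟨hSn, hSk⟩ := Finset.mem_powersetCard.1 hS
    have hmap : (Finset.univ.filter fun i : Fin (r + k) => (i : ℕ) ∈ S).map Fin.valEmbedding = S := by
      ext j
      simp only [Finset.mem_map, Finset.mem_filter, Finset.mem_univ, true_and,
        Fin.valEmbedding_apply]
      constructor
      · rintro ⟨i, hi, rfl⟩
        exact hi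
      · intro hj
        exact ⟨⟨j, Finset.mem_range.1 (hSn hj)⟩, hj, rfl⟩
    refine ⟨_, Finset.mem_filter.2 ⟨Finset.mem_univ _, ?_, ?_⟩, hmap⟩
    · rw [← Finset.card_map Fin.valEmbedding, hmap, hSk]
    · rw [hind, hmap]
      exact hSind

theorem theorem1p2 (k : ℕ) (hk : 3 ≤ k) :
    ∃ R : ℕ, ∀ r : ℕ, R ≤ r → ∀ b : ℕ, 1 ≤ b → b ≤ (r + k).choose r →
      ∃ M : Matroid (Fin (r + k)), IsWelshMatroid M (r + k) r b ∧ IsLinearMatroid ℚ M := by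
  obtain ⟨s, rfl⟩ : ∃ s, k = s + 1 := ⟨k - 1, by omega⟩
  obtain ⟨N, hN⟩ := exists_forall_hasBasisCount (s := s) (by omega)
  refine ⟨N, fun r hr b hb1 hb => ?_⟩
  rw [Nat.choose_symm_add] at hb
  exact (hN (r + (s + 1)) (by omega) b hb).exists_isWelshMatroid hb1
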